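/- Let $V$ be a countable set and let $P=(p(u,v))_{u,v\in V}$ be the transition matrix of a time-homogeneous Markov chain on $V$. Let $\partial\Gamma\subset V$ be any subset (the boundary) and $\mathrm{int}\,\Gamma=V\setminus\partial\Gamma$. For $a\in V$ and $b\in\partial\Gamma$ let $X(a,b)$ be the probability that the chain started at $a$ visits $\partial\Gamma$ at some time $n\ge 1$ and that the first boundary state visited at a time $n\ge 1$ is $b$. (If $a\in\partial\Gamma$, time $0$ does not count.) A possible trajectory connecting $a$ to $b$ through $\mathrm{int}\,\Gamma$ is a finite sequence $a=v_0,v_1,\dots,v_m=b$ with $m\ge 1$, $p(v_{r-1},v_r)>0$ for $1\le r\le m$, and $v_r\in\mathrm{int}\,\Gamma$ for $0<r<m$. The loop-erased part $\mathrm{LE}(\pi)$ of a walk $\pi=(v_0,\dots,v_m)$ is obtained by erasing its loops in chronological order: if the $v_r$ are distinct, $\mathrm{LE}(\pi)=\pi$; otherwise take the smallest $s$ for which $v_r=v_s$ for some $r<s$, delete $v_{r+1},\dots,v_s$, and repeat. For a trajectory $\pi=(v_0,\dots,v_m)$ that is stopped at its first visit to $\partial\Gamma$ after time $0$ and that satisfies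 $v_m=v_0$ (so $v_0\in\partial\Gamma$), the initial and final visits to $v_0$ are regarded as visits to two different points, that is, $\mathrm{LE}(\pi)$ then means $\mathrm{LE}(v_0,\dots,v_{m-1})$ followed by $v_m$. Let $a_1,\dots,a_k\in V$ be distinct and let $b_1,\dots,b_k\in\partial\Gamma$ be distinct. Suppose that whenever $i<i'$ and $j'<j$, every possible trajectory connecting $a_i$ to $b_j$ through $\mathrm{int}\,\Gamma$ and every possible trajectory connecting $a_{i'}$ to $b_{j'}$ through $\mathrm{int}\,\Gamma$ have a common vertex in $\mathrm{int}\,\Gamma$. Put $X_{A,B}=(X(a_i,b_j))_{i,j=1}^k$. Then $\det(X_{A,B})$ is equal to the probability that $k$ independent trajectories $\pi_1,\dots,\pi_k$ of the chain, started at $a_1,\dots,a_k$ respectively and each stopped at its first visit to $\partial\Gamma$ after time $0$, hit $\partial\Gamma$ at $b_1,\dots,b_k$ respectively, and that, for every $i=1,\dots,k-1$, the trajectory $\pi_{i+1}$ has no common vertex in $\mathrm{int}\,\Gamma$ with $\mathrm{LE}(\pi_i)$. In particular $\det(X_{A,B})\ge 0$, and moreover the matrix $X_{A,B}$ is totally nonnegative,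 that is, all its minors are nonnegative. -/

import Mathlib

open MeasureTheory ProbabilityTheory

namespace HittingMinors

/-! ### The Markov chain and its trajectories -/

section Chain

variable {V : Type*} [MeasurableSpace V]

/-- The transition kernel `P` of a time-homogeneous Markov chain, seen as a family of kernels
giving the law of the state at time `n + 1` from the whole history up to time `n`. -/
noncomputable def historyKernel (P : Kernel V V) (n : ℕ) :
    Kernel ((i : Finset.Iic n) → (fun _ : ℕ => V) i) V :=
  P.comap (fun h => h ⟨n, Finset.mem_Iic.2 le_rfl⟩) (measurable_pi_apply _)

instance (P : Kernel V V) [IsMarkovKernel P] (n : ℕ) : IsMarkovKernel (historyKernel P n) := by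
  unfold historyKernel; infer_instance

/-- The law, on the space `ℕ → V` of trajectories, of the Markov chain with transition kernel `P`
started at the state `a` at time `0`. -/
noncomputable def chainLaw (P : Kernel V V) [IsMarkovKernel P] (a : V) : Measure (ℕ → V) :=
  Kernel.traj (X := fun _ => V) (historyKernel P) 0 (fun _ => a)

instance (P : Kernel V V) [IsMarkovKernel P] (a : V) : IsProbabilityMeasure (chainLaw P a) := by
  unfold chainLaw; infer_instance

/-- The trajectory `ω` visits the boundary `S` for the first time, after the clock is started,
at time `n`. In particular `n` is positive, even if `ω 0` lies in `S`. -/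
def FirstHitsAt (S : Set V) (ω : ℕ → V) (n : ℕ) : Prop :=
  0 < n ∧ ω n ∈ S ∧ ∀ m, 0 < m → m < n → ω m ∉ S

/-- The hitting matrix: the entry at `(a, b)` is the probability that `b` is the first boundary
state hit by the chain that originates at `a`. -/
noncomputable def hittingMatrix (P : Kernel V V) [IsMarkovKernel P] (S : Set V) :
    Matrix V S ℝ :=
  fun a b => (chainLaw P a).real {ω | ∃ n, FirstHitsAt S ω n ∧ ω n = b}

/-- The list `l` of successive states is a possible trajectory connecting `a` to `b` through the
complement of `S`: it makes at least one step, every step has positive probability, and all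
states strictly between the endpoints lie outside `S`. -/
def IsTrajectory (P : Kernel V V) (S : Set V) (a b : V) (l : List V) : Prop :=
  l.IsChain (fun x y => P x {y} ≠ 0) ∧ ∃ mid : List V, l = a :: (mid ++ [b]) ∧ ∀ v ∈ mid, v ∉ S

/-- The crossing hypothesis: for `i < i'` and `j' < j`, any possible trajectory connecting `a i`
to `b j` through the interior and any possible trajectory connecting `a i'` to `b j'` through the
interior have a common interior state. -/
def TrajectoriesCross (P : Kernel V V) (S : Set V) {k : ℕ} (a : Fin k → V) (b : Fin k → S) :
    Prop :=
  ∀ i i' j j' : Fin k, i < i' → j' < j → ∀ p q : List V,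
    IsTrajectory P S (a i) (b j) p → IsTrajectory P S (a i') (b j') q →
      ∃ v, v ∉ S ∧ v ∈ p ∧ v ∈ q

end Chain

/-! ### Loop erasure -/

section LoopErasure

variable {V : Type*} [DecidableEq V]

/-- The loop-erased part of a walk, given by its successive vertices. The walk is read in order;
`p` is the self-avoiding path obtained so far. If the next vertex `v` lies on `p`, the walk has
just closed a loop, which is erased by cutting `p` back to `v`; otherwise `v` is appended. -/
def loopErase (l : List V) : List V :=
  l.foldl (fun p v => p.takeWhile (fun u => u ≠ v) ++ [v]) []

/-- The loop-erased part of a trajectory stopped upon hitting the boundary. This is the loop-erased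
part of the walk, except that, when the trajectory returns to its starting point at the final
step, the initial and the final visit to that point are not regarded as closing a loop: the final
step is kept. (The starting point is then a boundary state, seen once as a source and once as a
sink.) -/
def trajectoryLoopErase (l : List V) : List V :=
  if l.head? = l.getLast? then loopErase l.dropLast ++ l.getLast?.toList else loopErase l

end LoopErasure

/-- The successive states of the trajectory `ω` up to time `n`. -/
def walkUpTo {V : Type*} (ω : ℕ → V) (n : ℕ) : List V :=
  (List.range (n + 1)).map ω

/-- The event, for a `k`-tuple of trajectories `π`, that each `π i` first hits the boundary `S` at
`b i`, and that, for consecutive indices `i` and `j = i + 1`, the trajectory `π j` (up to its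
hitting time) has no common states with the loop-erased part of `π i` in the interior. -/
def nonintersectionEvent {V : Type*} [DecidableEq V] (S : Set V) {k : ℕ} (b : Fin k → S) :
    Set (Fin k → ℕ → V) :=
  {π | ∃ τ : Fin k → ℕ, (∀ i, FirstHitsAt S (π i) (τ i) ∧ π i (τ i) = b i) ∧
    ∀ i j : Fin k, (j : ℕ) = i + 1 → ∀ v, v ∉ S →
      v ∈ walkUpTo (π j) (τ j) → v ∉ trajectoryLoopErase (walkUpTo (π i) (τ i))}

/-- A real matrix is totally nonnegative if all its minors (with rows and columns taken in
increasing order) are nonnegative. -/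
def IsTotallyNonnegative {k : ℕ} (M : Matrix (Fin k) (Fin k) ℝ) : Prop :=
  ∀ (m : ℕ) (r c : Fin m → Fin k), StrictMono r → StrictMono c → 0 ≤ (M.submatrix r c).det

end HittingMinors

namespace HittingMinors

/-! ### Loop erasure and crossings of tuples of walks -/

section Combinatorics

variable {α : Type*}

/-! This is Fomin's variant of the Lindström–Gessel–Viennot argument. A stopped trajectory is
encoded by the list `l` of its interior states; boundary endpoints play no part in crossings. Let `w
i j l` be the probability that the chain from `a i` first hits the boundary at `b j` having visited
`l`. By the Markov property `w i j` factors at every vertex of `l` into a part depending on `i` and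
a part depending on `j` (`chainLaw_hitEvent_append_cons`). Expanding the determinant into a sum over
tuples `p` of lists gives the terms `det (w i j (p i))`.

Call `p` crossing if some `p j` meets the loop erasure of an earlier `p i`. At a canonical first
crossing, exchange the tails after the last visits to the crossing vertex. The first crossing
survives the exchange (`IsFirstCrossing.exchange`), so this is an involution, and by the
factorization it negates the term (`IsExchange.det_neg`): crossing tuples cancel.

For a noncrossing tuple, a permutation other than the identity has an inversion, where the
hypothesis forces an intersection, so only the diagonal product remains
(`det_eq_prod_of_not_hasCrossing`). Finally, a tuple of nonzero weight is noncrossing as soon as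
consecutive walks are disjoint in the required sense (`ConsecutiveDisjoint.not_hasCrossing`). Minors
inherit the crossing hypothesis, whence total nonnegativity. -/

theorem exists_eq_append_cons_last {c : List α} {v : α} (h : v ∈ c) :
    ∃ x y, c = x ++ v :: y ∧ v ∉ y := by
  obtain ⟨x, d, e, hx⟩ := List.eq_append_cons_of_mem (List.mem_reverse.2 h)
  refine ⟨d.reverse, x.reverse, ?_, by simpa using hx⟩
  rw [← List.reverse_reverse c, e]
  simp

/-- Cutting at the last visit is canonical; this is what makes the exchange of tails well defined.
-/
theorem append_cons_last_inj {x y x' y' : List α} {v : α} (h : x ++ v :: y = x' ++ v :: y')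
    (hy : v ∉ y) (hy' : v ∉ y') : x = x' ∧ y = y' := by
  rw [List.append_eq_append_iff] at h
  rcases h with ⟨t, rfl, h⟩ | ⟨t, rfl, h⟩ <;> rcases t with _ | ⟨s, t⟩ <;>
    simp only [List.nil_append, List.cons_append, List.cons.injEq, true_and] at h
  · simp [h]
  · exact absurd (h.2 ▸ by simp) hy
  · simp [h]
  · exact absurd (h.2 ▸ by simp) hy'

variable [DecidableEq α]

theorem takeWhile_ne_append_cons {c d : List α} {v : α} (h : v ∉ c) :
    (c ++ v :: d).takeWhile (fun u => u ≠ v) = c := by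
  rw [List.takeWhile_append_of_pos]
  · simp
  · intro u hu
    simpa using fun e : u = v => h (e ▸ hu)

theorem notMem_takeWhile_ne (c : List α) (v : α) : v ∉ c.takeWhile (fun u => u ≠ v) := by
  intro h
  simpa using List.mem_takeWhile_imp h

theorem eq_takeWhile_ne_append_cons {c : List α} {v : α} (h : v ∈ c) :
    ∃ d, c = c.takeWhile (fun u => u ≠ v) ++ v :: d := by
  obtain ⟨x, d, rfl, hx⟩ := List.eq_append_cons_of_mem h
  exact ⟨d, by rw [takeWhile_ne_append_cons hx]⟩

theorem loopErase_append (x y : List α) :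
    loopErase (x ++ y) =
      y.foldl (fun p v => p.takeWhile (fun u => u ≠ v) ++ [v]) (loopErase x) := by
  simp [loopErase, List.foldl_append]

theorem loopErase_append_cons (x y : List α) (v : α) :
    loopErase (x ++ v :: y) = y.foldl (fun p v => p.takeWhile (fun u => u ≠ v) ++ [v])
      ((loopErase x).takeWhile (fun u => u ≠ v) ++ v :: []) := by
  rw [loopErase_append, List.foldl_cons]

theorem loopErase_subset (l : List α) : loopErase l ⊆ l := by
  induction l using List.reverseRecOn with
  | nil => simp [loopErase]
  | append_singleton l v ih =>
    intro u hu
    rw [loopErase_append_cons, List.foldl_nil, List.mem_append] at hu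
    rcases hu with hu | hu
    · exact List.mem_append_left _ (ih (List.takeWhile_subset _ hu))
    · exact List.mem_append_right _ hu

/-- Returning to a vertex of `c` cuts the path back to before `v`, and `v` cannot reappear because
the rest of the walk avoids it. -/
theorem foldl_erase_of_mem {c y : List α} {v : α} (hc : v ∉ c) (hy : v ∉ y) (d : List α)
    (h : v ∈ y.foldl (fun p v => p.takeWhile (fun u => u ≠ v) ++ [v]) (c ++ v :: d)) :
    ∀ u ∈ y, u ∉ c := by
  induction y generalizing c d with
  | nil => simp
  | cons u y ih =>
    have huv : u ≠ v := fun e => hy (e ▸ List.mem_cons_self)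
    have hvy : v ∉ y := fun e => hy (List.mem_cons_of_mem _ e)
    rw [List.foldl_cons] at h
    by_cases huc : u ∈ c
    · exfalso
      -- Once off the path, a vertex that is not visited again stays off.
      have key : ∀ (z e : List α), v ∉ e → v ∉ z →
          v ∉ z.foldl (fun p v => p.takeWhile (fun u => u ≠ v) ++ [v]) e := by
        intro z
        induction z with
        | nil => intro e he _; exact he
        | cons t z ihz =>
          intro e he hz
          rw [List.foldl_cons]
          refine ihz _ ?_ (fun e => hz (List.mem_cons_of_mem _ e))
          intro hm
          rcases List.mem_append.1 hm with hm | hm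
          · exact he (List.takeWhile_subset _ hm)
          · exact hz (by rw [List.mem_singleton.1 hm]; exact List.mem_cons_self)
      refine key y _ ?_ hvy h
      obtain ⟨c1, c2, rfl, hu1⟩ := List.eq_append_cons_of_mem huc
      rw [List.append_assoc, List.cons_append, takeWhile_ne_append_cons hu1]
      intro hm
      rcases List.mem_append.1 hm with hm | hm
      · exact hc (List.mem_append_left _ hm)
      · exact huv (List.mem_singleton.1 hm).symm
    · have e : (c ++ v :: d).takeWhile (fun t => t ≠ u) ++ [u] =
          c ++ v :: (d.takeWhile (fun t => t ≠ u) ++ [u]) := by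
        rw [List.takeWhile_append_of_pos]
        · simp [huv.symm]
        · intro t ht
          simpa using fun e : t = u => huc (e ▸ ht)
      rw [e] at h
      have := ih hc hvy _ h
      intro t ht
      rcases List.mem_cons.1 ht with rfl | ht
      · exact huc
      · exact this t ht

/-- Every loop closed while `y` is read is based strictly after `v`, so no cut reaches `c` or `v`.
-/
theorem foldl_erase_of_disjoint {c y : List α} {v : α} (hy : v ∉ y) (d : List α)
    (h : ∀ u ∈ y, u ∉ c) :
    ∃ e, y.foldl (fun p v => p.takeWhile (fun u => u ≠ v) ++ [v]) (c ++ v :: d) = c ++ v :: e := by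
  induction y generalizing d with
  | nil => exact ⟨d, rfl⟩
  | cons u y ih =>
    have huv : u ≠ v := fun e => hy (e ▸ List.mem_cons_self)
    have huc : u ∉ c := h u List.mem_cons_self
    have e : (c ++ v :: d).takeWhile (fun t => t ≠ u) ++ [u] =
          c ++ v :: (d.takeWhile (fun t => t ≠ u) ++ [u]) := by
      rw [List.takeWhile_append_of_pos]
      · simp [huv.symm]
      · intro t ht
        simpa using fun e : t = u => huc (e ▸ ht)
    rw [List.foldl_cons, e]
    exact ih (fun e => hy (List.mem_cons_of_mem _ e)) _
      (fun t ht => h t (List.mem_cons_of_mem _ ht))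

/-- If `v` is visited for the last time between `x` and `y`, and survives the loop erasure, then
the walk `y` avoids the part of the loop erasure that precedes `v`. -/
theorem disjoint_of_mem_loopErase {x y : List α} {v : α} (hy : v ∉ y)
    (h : v ∈ loopErase (x ++ v :: y)) :
    ∀ u ∈ y, u ∉ (loopErase x).takeWhile (fun u => u ≠ v) := by
  rw [loopErase_append_cons] at h
  exact foldl_erase_of_mem (notMem_takeWhile_ne _ _) hy _ h

theorem loopErase_of_disjoint {x y : List α} {v : α} (hy : v ∉ y)
    (h : ∀ u ∈ y, u ∉ (loopErase x).takeWhile (fun u => u ≠ v)) :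
    ∃ e, loopErase (x ++ v :: y) = (loopErase x).takeWhile (fun u => u ≠ v) ++ v :: e := by
  rw [loopErase_append_cons]
  exact foldl_erase_of_disjoint hy _ h

theorem takeWhile_loopErase_of_disjoint {x y : List α} {v : α} (hy : v ∉ y)
    (h : ∀ u ∈ y, u ∉ (loopErase x).takeWhile (fun u => u ≠ v)) :
    (loopErase (x ++ v :: y)).takeWhile (fun u => u ≠ v) =
      (loopErase x).takeWhile (fun u => u ≠ v) := by
  obtain ⟨e, he⟩ := loopErase_of_disjoint hy h
  rw [he, takeWhile_ne_append_cons (notMem_takeWhile_ne _ _)]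

/-! ### First crossings and the exchange of tails -/

variable {k : ℕ}

/-- Some walk of the tuple `p` meets the loop erasure of an earlier one. -/
def HasCrossing (p : Fin k → List α) : Prop :=
  ∃ i j, i < j ∧ ∃ v ∈ loopErase (p i), v ∈ p j

/-- The crossing of the walk `p j` with the loop erasure of `p i` at the vertex `v` is the first
one: `i` is the least index whose loop erasure meets a later walk, `v` is the first vertex of this
loop erasure that lies on a later walk, and `j` is the least index of such a walk. -/
structure IsFirstCrossing (p : Fin k → List α) (i : Fin k) (v : α) (j : Fin k) : Prop where
  lt : i < j
  mem : v ∈ p j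
  mem_loopErase : v ∈ loopErase (p i)
  row_min : ∀ i' < i, ∀ j' > i', ∀ u ∈ loopErase (p i'), u ∉ p j'
  vertex_min : ∀ u ∈ (loopErase (p i)).takeWhile (fun u => u ≠ v), ∀ j' > i, u ∉ p j'
  col_min : ∀ j' > i, j' < j → v ∉ p j'

/-- Minimize successively: the row `i`, then the position of `v` along the loop erasure of `p i`,
then the row `j`. -/
theorem HasCrossing.exists_isFirstCrossing {p : Fin k → List α} (h : HasCrossing p) :
    ∃ i v j, IsFirstCrossing p i v j := by
  have first : ∀ (Q : α → Prop) (l : List α), (∃ v ∈ l, Q v) →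
      ∃ v ∈ l, Q v ∧ ∀ u ∈ l.takeWhile (fun u => u ≠ v), ¬ Q u := by
    intro Q l
    induction l with
    | nil => rintro ⟨v, hv, -⟩; simp at hv
    | cons t l ih =>
      rintro ⟨v, hv, hQ⟩
      by_cases ht : Q t
      · exact ⟨t, List.mem_cons_self, ht, by simp⟩
      · have hv' : v ∈ l := by
          rcases List.mem_cons.1 hv with rfl | hv
          · exact absurd hQ ht
          · exact hv
        obtain ⟨v, hv, hQ, hmin⟩ := ih ⟨v, hv', hQ⟩
        refine ⟨v, List.mem_cons_of_mem _ hv, hQ, ?_⟩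
        have htv : t ≠ v := fun e => ht (e ▸ hQ)
        rw [List.takeWhile_cons_of_pos (by simpa using htv)]
        intro u hu
        rcases List.mem_cons.1 hu with rfl | hu
        · exact ht
        · exact hmin u hu
  obtain ⟨i, ⟨j, hij, v, hv, hvj⟩, hi⟩ :=
    WellFounded.has_min (wellFounded_lt (α := Fin k))
      {i | ∃ j, i < j ∧ ∃ v ∈ loopErase (p i), v ∈ p j} h
  obtain ⟨v, hv, ⟨j, hij, hvj⟩, hvmin⟩ := first (fun v => ∃ j, i < j ∧ v ∈ p j)
    (loopErase (p i)) ⟨v, hv, j, hij, hvj⟩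
  obtain ⟨j, ⟨hij, hvj⟩, hj⟩ := WellFounded.has_min (wellFounded_lt (α := Fin k))
      {j | i < j ∧ v ∈ p j} ⟨j, hij, hvj⟩
  refine ⟨i, v, j, hij, hvj, hv, ?_, ?_, ?_⟩
  · intro i' hi' j' hj' u hu huj
    exact hi i' ⟨j', hj', u, hu, huj⟩ hi'
  · intro u hu j' hj' huj
    exact hvmin u hu ⟨j', hj', huj⟩
  · intro j' hij' hj' hvj'
    exact hj j' ⟨hij', hvj'⟩ hj'

theorem IsFirstCrossing.unique {p : Fin k → List α} {i j i' j' : Fin k} {v v' : α}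
    (h : IsFirstCrossing p i v j) (h' : IsFirstCrossing p i' v' j') :
    i = i' ∧ v = v' ∧ j = j' := by
  obtain rfl : i = i' := by
    rcases lt_trichotomy i i' with hlt | rfl | hlt
    · exact absurd h.mem (h'.row_min i hlt j h.lt v h.mem_loopErase)
    · rfl
    · exact absurd h'.mem (h.row_min i' hlt j' h'.lt v' h'.mem_loopErase)
  obtain rfl : v = v' := by
    by_contra hne
    obtain ⟨d, hd⟩ := eq_takeWhile_ne_append_cons h.mem_loopErase
    have hv' : v' ∉ (loopErase (p i)).takeWhile (fun u => u ≠ v) := fun hm =>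
      h.vertex_min v' hm j' h'.lt h'.mem
    refine h'.vertex_min v ?_ j h.lt h.mem
    rw [hd, List.takeWhile_append_of_pos]
    · simp [hne]
    · intro t ht
      simpa using fun e : t = v' => hv' (e ▸ ht)
  refine ⟨rfl, rfl, ?_⟩
  rcases lt_trichotomy j j' with hlt | rfl | hlt
  · exact absurd h.mem (h'.col_min j h.lt hlt)
  · rfl
  · exact absurd h'.mem (h.col_min j' h'.lt hlt)

/-- Exchanging the parts of two walks that follow the last visits to the vertex of the first
crossing does not change the first crossing. -/
theorem IsFirstCrossing.exchange {p q : Fin k → List α} {i j : Fin k} {v : α}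
    (h : IsFirstCrossing p i v j) {xi yi xj yj : List α}
    (hpi : p i = xi ++ v :: yi) (hyi : v ∉ yi) (hpj : p j = xj ++ v :: yj) (hyj : v ∉ yj)
    (hqi : q i = xi ++ v :: yj) (hqj : q j = xj ++ v :: yi)
    (hq : ∀ l, l ≠ i → l ≠ j → q l = p l) : IsFirstCrossing q i v j := by
  have hlt := h.lt
  -- The loop erasure up to `v` depends only on `xi` as long as the tail avoids it: `yi` does
  -- because `v` survives the erasure, `yj` by minimality of `v`.
  have hdi : ∀ u ∈ yi, u ∉ (loopErase xi).takeWhile (fun u => u ≠ v) :=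
    disjoint_of_mem_loopErase hyi (hpi ▸ h.mem_loopErase)
  have hmin : ∀ u ∈ (loopErase xi).takeWhile (fun u => u ≠ v), ∀ j' > i, u ∉ p j' := by
    have := h.vertex_min
    rwa [hpi, takeWhile_loopErase_of_disjoint hyi hdi] at this
  have hdj : ∀ u ∈ yj, u ∉ (loopErase xi).takeWhile (fun u => u ≠ v) := fun u hu hm =>
    hmin u hm j hlt (by rw [hpj]; simp [hu])
  refine ⟨hlt, by simp [hqj], ?_, ?_, ?_, ?_⟩
  · obtain ⟨e, he⟩ := loopErase_of_disjoint hyj hdj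
    simp [hqi, he]
  · intro i' hi' j' hj' u hu
    -- Loop erasures of rows before `i` avoid both old walks, hence all four pieces.
    rw [hq i' hi'.ne (hi'.trans hlt).ne] at hu
    have h1 : u ∉ xi ++ v :: yi := hpi ▸ h.row_min i' hi' i hi' u hu
    have h2 : u ∉ xj ++ v :: yj := hpj ▸ h.row_min i' hi' j (hi'.trans hlt) u hu
    simp only [List.mem_append, List.mem_cons, not_or] at h1 h2
    by_cases e1 : j' = i
    · rw [e1, hqi]; simp [h1, h2]
    by_cases e2 : j' = j
    · rw [e2, hqj]; simp [h1, h2]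
    rw [hq j' e1 e2]
    exact h.row_min i' hi' j' hj' u hu
  · rw [hqi, takeWhile_loopErase_of_disjoint hyj hdj]
    intro u hu j' hj'
    by_cases e2 : j' = j
    · have h2 : u ∉ xj ++ v :: yj := hpj ▸ hmin u hu j hlt
      have h3 : u ∉ yi := fun hm => hdi u hm hu
      simp only [List.mem_append, List.mem_cons, not_or] at h2
      rw [e2, hqj]; simp [h2, h3]
    rw [hq j' hj'.ne' e2]
    exact hmin u hu j' hj'
  · intro j' hj' hj
    rw [hq j' hj'.ne' hj.ne]
    exact h.col_min j' hj' hj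

/-- The tuple `q` arises from `p` by exchanging the tails of two walks at the first crossing. -/
def IsExchange (p q : Fin k → List α) : Prop :=
  ∃ (i j : Fin k) (v : α) (xi yi xj yj : List α), IsFirstCrossing p i v j ∧
    IsFirstCrossing q i v j ∧ v ∉ yi ∧ v ∉ yj ∧ p i = xi ++ v :: yi ∧ p j = xj ++ v :: yj ∧
    q i = xi ++ v :: yj ∧ q j = xj ++ v :: yi ∧ ∀ l, l ≠ i → l ≠ j → q l = p l

theorem IsExchange.symm {p q : Fin k → List α} (h : IsExchange p q) : IsExchange q p := by
  obtain ⟨i, j, v, xi, yi, xj, yj, hp, hq, h1, h2, h3, h4, h5, h6, h7⟩ := h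
  exact ⟨i, j, v, xi, yj, xj, yi, hq, hp, h2, h1, h5, h6, h3, h4,
    fun l hi hj => (h7 l hi hj).symm⟩

/-- With `IsExchange.symm`, this makes any choice of exchanged tuple an involution. -/
theorem IsExchange.unique {p q q' : Fin k → List α} (h : IsExchange p q)
    (h' : IsExchange p q') : q = q' := by
  obtain ⟨i, j, v, xi, yi, xj, yj, hp, hq, h1, h2, h3, h4, h5, h6, h7⟩ := h
  obtain ⟨i', j', v', xi', yi', xj', yj', hp', hq', h1', h2', h3', h4', h5', h6', h7'⟩ := h'
  obtain ⟨rfl, rfl, rfl⟩ := hp.unique hp'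
  obtain ⟨rfl, rfl⟩ := append_cons_last_inj (h3.symm.trans h3') h1 h1'
  obtain ⟨rfl, rfl⟩ := append_cons_last_inj (h4.symm.trans h4') h2 h2'
  funext l
  by_cases e1 : l = i
  · rw [e1, h5, h5']
  by_cases e2 : l = j
  · rw [e2, h6, h6']
  rw [h7 l e1 e2, h7' l e1 e2]

theorem HasCrossing.exists_isExchange {p : Fin k → List α} (h : HasCrossing p) :
    ∃ q, IsExchange p q := by
  obtain ⟨i, v, j, hp⟩ := h.exists_isFirstCrossing
  obtain ⟨xi, yi, hpi, hyi⟩ := exists_eq_append_cons_last (loopErase_subset _ hp.mem_loopErase)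
  obtain ⟨xj, yj, hpj, hyj⟩ := exists_eq_append_cons_last hp.mem
  have hij := hp.lt.ne
  let q := Function.update (Function.update p i (xi ++ v :: yj)) j (xj ++ v :: yi)
  have hqi : q i = xi ++ v :: yj := by simp [q, hij]
  have hqj : q j = xj ++ v :: yi := by simp [q]
  have hq : ∀ l, l ≠ i → l ≠ j → q l = p l := fun l h1 h2 => by simp [q, h1, h2]
  exact ⟨q, i, j, v, xi, yi, xj, yj, hp, hp.exchange hpi hyi hpj hyj hqi hqj hq, hyi, hyj, hpi,
    hpj, hqi, hqj, hq⟩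

theorem IsExchange.hasCrossing {p q : Fin k → List α} (h : IsExchange p q) : HasCrossing p := by
  obtain ⟨i, j, v, -, -, -, -, hp, -⟩ := h
  exact ⟨i, j, hp.lt, v, hp.mem_loopErase, hp.mem⟩

/-- The sum of a function that changes its sign under exchange of tails, over all tuples of walks
with a crossing, vanishes. -/
theorem tsum_eq_zero_of_isExchange (f : (Fin k → List α) → ℝ)
    (hf : ∀ p q, IsExchange p q → f q = - f p) (h0 : ∀ p, ¬ HasCrossing p → f p = 0) :
    ∑' p, f p = 0 := by
  classical
  let F : (Fin k → List α) → (Fin k → List α) := fun p =>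
    if h : HasCrossing p then h.exists_isExchange.choose else p
  have hF : ∀ p, HasCrossing p → IsExchange p (F p) := fun p h => by
    simp only [F, dif_pos h]
    exact h.exists_isExchange.choose_spec
  have hF' : ∀ p, ¬ HasCrossing p → F p = p := fun p h => by simp only [F, dif_neg h]
  have hinv : Function.Involutive F := fun p => by
    by_cases h : HasCrossing p
    · have h1 := (hF p h).symm
      exact (hF _ h1.hasCrossing).unique h1
    · rw [hF' p h, hF' p h]
  have hneg : ∀ p, f (F p) = - f p := fun p => by
    by_cases h : HasCrossing p
    · exact hf p _ (hF p h)
    · rw [hF' p h, h0 p h, neg_zero]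
  -- Reindexing and negation hold for `tsum` without summability.
  have h1 : ∑' p, f (F p) = ∑' p, f p := hinv.toPerm.tsum_eq f
  simp only [hneg, tsum_neg] at h1
  linarith

/-- Exchanging tails changes the sign of the determinant of the weights. -/
theorem IsExchange.det_neg {w : Fin k → Fin k → List α → ℝ} {A B : Fin k → List α → ℝ}
    (hw : ∀ i j x v y, w i j (x ++ v :: y) = A i (x ++ [v]) * B j (v :: y))
    {p q : Fin k → List α} (h : IsExchange p q) :
    (Matrix.of fun i j => w i j (q i)).det = - (Matrix.of fun i j => w i j (p i)).det := by
  obtain ⟨i, j, v, xi, yi, xj, yj, hp, -, -, -, h3, h4, h5, h6, h7⟩ := h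
  have hij : i ≠ j := hp.lt.ne
  rw [← Matrix.det_transpose, ← Matrix.det_transpose (Matrix.of fun i j => w i j (p i)),
    Matrix.det_apply', Matrix.det_apply', ← Finset.sum_neg_distrib]
  -- After the exchange, row `i` ends with the old tail of row `j` and vice versa, so the term of
  -- `σ` is the old term of `σ * swap i j`, up to sign.
  refine Fintype.sum_equiv (Equiv.mulRight (Equiv.swap i j)) _ _ fun σ => ?_
  have hprod : ∏ l, w l (σ l) (q l) = ∏ l, w l ((σ * Equiv.swap i j) l) (p l) := by
    have hj : j ∈ Finset.univ.erase i := by simp [hij.symm]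
    rw [← Finset.mul_prod_erase _ _ (Finset.mem_univ i), ← Finset.mul_prod_erase _ _ hj,
      ← Finset.mul_prod_erase Finset.univ _ (Finset.mem_univ i),
      ← Finset.mul_prod_erase (Finset.univ.erase i) _ hj, ← mul_assoc, ← mul_assoc]
    congr 1
    · simp only [Equiv.Perm.mul_apply, Equiv.swap_apply_left, Equiv.swap_apply_right, h3, h4, h5,
        h6, hw]
      ring
    · refine Finset.prod_congr rfl fun l hl => ?_
      simp only [Finset.mem_erase, Finset.mem_univ, and_true] at hl
      rw [h7 l hl.2 hl.1, Equiv.Perm.mul_apply, Equiv.swap_apply_of_ne_of_ne hl.2 hl.1]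
  simp only [Matrix.transpose_apply, Matrix.of_apply, Equiv.coe_mulRight, hprod]
  simp [Equiv.Perm.sign_mul, Equiv.Perm.sign_swap hij]

/-- Erasing loops preserves the property of having nonzero weight. -/
theorem weight_loopErase_ne_zero {w A B : List α → ℝ}
    (hw : ∀ x v y, w (x ++ v :: y) = A (x ++ [v]) * B (v :: y)) {p : List α} (hp : w p ≠ 0) :
    w (loopErase p) ≠ 0 := by
  -- Invariant: the current path `c` followed by the unread walk `y` has nonzero weight. Erasing a
  -- loop at `v` glues a prefix and a suffix ending and starting at `v`.
  suffices h : ∀ y c : List α, w (c ++ y) ≠ 0 →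
      w (y.foldl (fun p v => p.takeWhile (fun u => u ≠ v) ++ [v]) c) ≠ 0 from h p [] (by simpa)
  intro y
  induction y with
  | nil => intro c hc; simpa using hc
  | cons v y ih =>
    intro c hc
    rw [List.foldl_cons]
    apply ih
    by_cases hv : v ∈ c
    · obtain ⟨d, hd⟩ := eq_takeWhile_ne_append_cons hv
      have h1 : A (c.takeWhile (fun u => u ≠ v) ++ [v]) ≠ 0 := by
        rw [hd, List.append_assoc, List.cons_append, hw] at hc
        exact left_ne_zero_of_mul hc
      have h2 : B (v :: y) ≠ 0 := by
        rw [hw] at hc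
        exact right_ne_zero_of_mul hc
      rw [List.append_assoc, List.singleton_append, hw]
      exact mul_ne_zero h1 h2
    · rw [List.takeWhile_eq_self_iff.2]
      · simpa using hc
      · intro u hu
        simpa using fun e : u = v => hv (e ▸ hu)

/-- No walk of the tuple meets the loop erasure of the preceding one. -/
def ConsecutiveDisjoint (p : Fin k → List α) : Prop :=
  ∀ i j : Fin k, (j : ℕ) = i + 1 → ∀ v ∈ p j, v ∉ loopErase (p i)

theorem consecutiveDisjoint_of_not_hasCrossing {p : Fin k → List α} (h : ¬ HasCrossing p) :
    ConsecutiveDisjoint p := by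
  intro i j hij v hv hvi
  exact h ⟨i, j, Fin.lt_def.2 (by omega), v, hvi, hv⟩

/-! ### Fomin's identity for abstract weights -/

section Crossing

variable {w : Fin k → Fin k → List α → ℝ} {A B : Fin k → List α → ℝ}

/-- Induction on the gap `j - i`. If `p j` meets the loop erasure of `p i` at `v`, follow the latter
to `v` and then `p j`. This walk leads from source `i` to sink `j`, so it must meet the loop erasure
of `p (i + 1)`: before `v` this contradicts consecutive disjointness, from `v` on the induction
hypothesis. -/
theorem ConsecutiveDisjoint.not_hasCrossing
    (hw : ∀ i j x v y, w i j (x ++ v :: y) = A i (x ++ [v]) * B j (v :: y))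
    (hcross : ∀ i i' j j' : Fin k, i < i' → j' < j → ∀ p q, w i j p ≠ 0 → w i' j' q ≠ 0 →
      ∃ v ∈ p, v ∈ q)
    {p : Fin k → List α} (hp : ∀ i, w i i (p i) ≠ 0) (h : ConsecutiveDisjoint p) :
    ¬ HasCrossing p := by
  have hL : ∀ i, w i i (loopErase (p i)) ≠ 0 := fun i => weight_loopErase_ne_zero (hw i i) (hp i)
  have key : ∀ (n : ℕ) (i j : Fin k), (j : ℕ) = i + n + 1 → ∀ v ∈ p j, v ∉ loopErase (p i) := by
    intro n
    induction n with
    | zero => exact h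
    | succ n ih =>
      intro i j hij v hvj hvi
      have hj := j.2
      let m : Fin k := ⟨i + 1, by omega⟩
      obtain ⟨c, d, hc⟩ := List.append_of_mem hvi
      obtain ⟨x, y, hx⟩ := List.append_of_mem hvj
      have h1 : A i (c ++ [v]) ≠ 0 := by
        have := hL i
        rw [hc, hw] at this
        exact left_ne_zero_of_mul this
      have h2 : B j (v :: y) ≠ 0 := by
        have := hp j
        rw [hx, hw] at this
        exact right_ne_zero_of_mul this
      obtain ⟨u, hu, hum⟩ := hcross i m j m (Fin.lt_def.2 (by simp [m]))
        (Fin.lt_def.2 (by simp [m]; omega)) (c ++ v :: y) (loopErase (p m))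
        (by rw [hw]; exact mul_ne_zero h1 h2) (hL m)
      rcases List.mem_append.1 hu with hu | hu
      · exact h i m rfl u (loopErase_subset _ hum) (by rw [hc]; simp [hu])
      · exact ih m j (by simp [m]; omega) u (by rw [hx]; exact List.mem_append_right _ hu) hum
  rintro ⟨i, j, hij, v, hvi, hvj⟩
  exact key (j - i - 1) i j (by have := Fin.lt_def.1 hij; omega) v hvj hvi

theorem det_eq_prod_of_not_hasCrossing
    (hw : ∀ i j x v y, w i j (x ++ v :: y) = A i (x ++ [v]) * B j (v :: y))
    (hcross : ∀ i i' j j' : Fin k, i < i' → j' < j → ∀ p q, w i j p ≠ 0 → w i' j' q ≠ 0 →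
      ∃ v ∈ p, v ∈ q)
    {p : Fin k → List α} (h : ¬ HasCrossing p) :
    (Matrix.of fun i j => w i j (p i)).det = ∏ i, w i i (p i) := by
  rw [← Matrix.det_transpose, Matrix.det_apply', Finset.sum_eq_single 1]
  · simp
  · intro σ _ hσ
    -- A permutation without inversions is strictly increasing, hence the identity.
    have : ∃ i i', i < i' ∧ σ i' < σ i := by
      by_contra! hcon
      apply hσ
      have hm : StrictMono σ := fun i i' hlt =>
        lt_of_le_of_ne (hcon i i' hlt) (fun e => hlt.ne (σ.injective e))
      have := (hm.range_inj strictMono_id).1 (by simp [σ.surjective.range_eq])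
      exact Equiv.ext (congrFun this)
    obtain ⟨i, i', hlt, hσ'⟩ := this
    rw [mul_eq_zero]
    right
    by_contra hne
    replace hne := Finset.prod_ne_zero_iff.1 hne
    obtain ⟨v, hv, hv'⟩ := hcross i i' (σ i) (σ i') hlt hσ' _ _
      (weight_loopErase_ne_zero (hw i (σ i)) (hne i (Finset.mem_univ _)))
      (hne i' (Finset.mem_univ _))
    exact h ⟨i, i', hlt, v, hv, hv'⟩
  · simp

open Classical in
/-- Fomin's identity: if crossing is unavoidable for pairs of walks whose ends are in the reverse
order, the determinant of the total weights is the total weight of the tuples of walks in which no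
walk meets the loop erasure of the preceding one. -/
theorem det_tsum_eq_tsum_consecutiveDisjoint
    (hw : ∀ i j x v y, w i j (x ++ v :: y) = A i (x ++ [v]) * B j (v :: y))
    (hcross : ∀ i i' j j' : Fin k, i < i' → j' < j → ∀ p q, w i j p ≠ 0 → w i' j' q ≠ 0 →
      ∃ v ∈ p, v ∈ q) {M : Matrix (Fin k) (Fin k) ℝ}
    (hM : ∀ σ : Equiv.Perm (Fin k),
      HasSum (fun p : Fin k → List α => ∏ i, w i (σ i) (p i)) (∏ i, M i (σ i))) :
    M.det = ∑' p : Fin k → List α, if ConsecutiveDisjoint p then ∏ i, w i i (p i) else 0 := by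
  let D : (Fin k → List α) → ℝ := fun p => (Matrix.of fun i j => w i j (p i)).det
  have hD : HasSum D M.det := by
    have : D = fun p => ∑ σ : Equiv.Perm (Fin k), (Equiv.Perm.sign σ : ℝ) *
        ∏ i, w i (σ i) (p i) := by
      funext p
      simp only [D]
      rw [← Matrix.det_transpose, Matrix.det_apply']
      rfl
    rw [this, ← Matrix.det_transpose, Matrix.det_apply']
    exact hasSum_sum fun σ _ => (hM σ).mul_left _
  have hbad : Summable ({p | HasCrossing p}.indicator D) := hD.summable.indicator _
  have hgood : Summable ({p | HasCrossing p}ᶜ.indicator D) := hD.summable.indicator _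
  have hzero : ∑' p, {p | HasCrossing p}.indicator D p = 0 := by
    refine tsum_eq_zero_of_isExchange _ (fun p q h => ?_) fun p (h : p ∉ {p | HasCrossing p}) =>
      Set.indicator_of_notMem h _
    rw [Set.indicator_of_mem (show q ∈ {p | HasCrossing p} from h.symm.hasCrossing),
      Set.indicator_of_mem (show p ∈ {p | HasCrossing p} from h.hasCrossing)]
    exact h.det_neg hw
  rw [← hD.tsum_eq, ← Set.indicator_self_add_compl {p | HasCrossing p} D]
  simp only [Pi.add_apply]
  rw [hbad.tsum_add hgood, hzero, zero_add]
  refine tsum_congr fun p => ?_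
  by_cases h : HasCrossing p
  · rw [Set.indicator_of_notMem (by simpa using h)]
    split_ifs with hc
    -- A crossing tuple can be consecutively disjoint only if its diagonal product vanishes.
    · by_contra hne
      exact hc.not_hasCrossing hw hcross
        (fun i => Finset.prod_ne_zero_iff.1 (Ne.symm hne) i (Finset.mem_univ _)) h
    · rfl
  · rw [Set.indicator_of_mem (by simpa using h), if_pos (consecutiveDisjoint_of_not_hasCrossing h)]
    exact det_eq_prod_of_not_hasCrossing hw hcross h

end Crossing

end Combinatorics

end HittingMinors

namespace HittingMinors

/-! ### Finite-dimensional distributions of the chain -/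

section Cylinders

variable {V : Type*}

theorem walkUpTo_succ (ω : ℕ → V) (n : ℕ) : walkUpTo ω (n + 1) = walkUpTo ω n ++ [ω (n + 1)] := by
  simp [walkUpTo, List.range_succ]

theorem walkUpTo_eq_iff {ω x : ℕ → V} {n : ℕ} :
    walkUpTo ω n = walkUpTo x n ↔ ∀ i ≤ n, ω i = x i := by
  simp [walkUpTo, List.map_inj_left]

theorem exists_eq_walkUpTo {m : List V} {n : ℕ} (h : m.length = n + 1) :
    ∃ x : ℕ → V, m = walkUpTo x n := by
  have : Nonempty V := ⟨m[0]⟩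
  refine ⟨fun i => m.getD i (Classical.arbitrary V), List.ext_getElem (by simp [walkUpTo, h]) ?_⟩
  intro i h1 h2
  simp [walkUpTo, h1]

variable [MeasurableSpace V]

/-- The product of the transition probabilities along a walk. -/
noncomputable def walkWeight (P : Kernel V V) : List V → ENNReal
  | [] => 1
  | [_] => 1
  | x :: y :: l => P x {y} * walkWeight P (y :: l)

theorem walkWeight_append_cons (P : Kernel V V) (x : List V) (v : V) (y : List V) :
    walkWeight P (x ++ v :: y) = walkWeight P (x ++ [v]) * walkWeight P (v :: y) := by
  induction x with
  | nil => simp [walkWeight]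
  | cons u x ih =>
    rcases x with _ | ⟨t, x⟩
    · simp [walkWeight]
    · simp only [List.cons_append, walkWeight, mul_assoc] at ih ⊢
      rw [ih]

theorem isChain_of_walkWeight_ne_zero {P : Kernel V V} {l : List V} (h : walkWeight P l ≠ 0) :
    l.IsChain (fun x y => P x {y} ≠ 0) := by
  induction l with
  | nil => simp
  | cons u l ih =>
    rcases l with _ | ⟨t, l⟩
    · simp
    · rw [walkWeight] at h
      exact List.IsChain.cons_cons (left_ne_zero_of_mul h) (ih (right_ne_zero_of_mul h))

theorem walkWeight_walkUpTo_succ (P : Kernel V V) (x : ℕ → V) (n : ℕ) :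
    walkWeight P (walkUpTo x (n + 1)) = walkWeight P (walkUpTo x n) * P (x n) {x (n + 1)} := by
  obtain ⟨l, hl⟩ : ∃ l, walkUpTo x n = l ++ [x n] := by
    simp [walkUpTo, List.range_succ]
  rw [walkUpTo_succ, hl, List.append_assoc, List.singleton_append, walkWeight_append_cons]
  simp [walkWeight]

variable [DiscreteMeasurableSpace V]

theorem measurableSet_eval_mem (T : Set V) (n : ℕ) : MeasurableSet {ω : ℕ → V | ω n ∈ T} :=
  (measurable_pi_apply n : Measurable fun ω : ℕ → V => ω n) (MeasurableSet.of_discrete (s := T))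

theorem measurableSet_eval_eq (v : V) (n : ℕ) : MeasurableSet {ω : ℕ → V | ω n = v} :=
  measurableSet_eval_mem {v} n

variable [Countable V]

/-- Integrate over the history up to time `n`: only the history of `x` contributes, and there the
next step depends on `x n` alone. -/
theorem partialTraj_succ_singleton (P : Kernel V V) [IsMarkovKernel P] (x : ℕ → V) (n : ℕ)
    (z : (i : Finset.Iic 0) → (fun _ : ℕ => V) i) :
    Kernel.partialTraj (X := fun _ => V) (historyKernel P) 0 (n + 1) z
        {Preorder.frestrictLe (n + 1) x} =
      Kernel.partialTraj (X := fun _ => V) (historyKernel P) 0 n z {Preorder.frestrictLe n x} *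
        P (x n) {x (n + 1)} := by
  have hs := measurable_IicProdIoc (X := fun _ => V) (m := n) (n := n + 1)
    (measurableSet_singleton (Preorder.frestrictLe (n + 1) x))
  have hmap := Kernel.map_apply' ((Kernel.id ×ₖ (historyKernel P n).map
    (MeasurableEquiv.piSingleton (X := fun _ => V) n)) ∘ₖ
      Kernel.partialTraj (X := fun _ => V) (historyKernel P) 0 n)
    (measurable_IicProdIoc (X := fun _ => V) (m := n) (n := n + 1)) z
    (measurableSet_singleton (Preorder.frestrictLe (n + 1) x))
  rw [Kernel.partialTraj_succ_of_le (Nat.zero_le n), hmap, Kernel.comp_apply' _ _ _ hs]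
  have hint : ∀ y : (i : Finset.Iic n) → (fun _ : ℕ => V) i,
      (Kernel.id ×ₖ (historyKernel P n).map (MeasurableEquiv.piSingleton (X := fun _ => V) n)) y
        (IicProdIoc (X := fun _ => V) n (n + 1) ⁻¹' {Preorder.frestrictLe (n + 1) x}) =
      ({Preorder.frestrictLe n x} : Set _).indicator (fun _ => P (x n) {x (n + 1)}) y := by
    intro y
    rw [Kernel.id_prod_apply' _ _ hs,
      Kernel.map_apply' _ (MeasurableEquiv.measurable _) _ (measurable_prodMk_left hs),
      historyKernel, Kernel.comap_apply]
    by_cases hy : y = Preorder.frestrictLe n x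
    · subst hy
      rw [Set.indicator_of_mem (Set.mem_singleton _)]
      congr 1
      ext t
      simp only [Set.mem_preimage, Set.mem_singleton_iff]
      constructor
      · intro h
        have := congrFun h ⟨n + 1, by simp⟩
        simpa [IicProdIoc, MeasurableEquiv.piSingleton] using this
      · rintro rfl
        ext ⟨i, hi⟩
        simp only [IicProdIoc]
        split_ifs with h
        · rfl
        · obtain rfl : i = n + 1 := by have := Finset.mem_Iic.1 hi; omega
          simp [MeasurableEquiv.piSingleton]
    · rw [Set.indicator_of_notMem (by simpa using hy)]
      convert measure_empty (μ := P _)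
      ext t
      simp only [Set.mem_preimage, Set.mem_singleton_iff, Set.mem_empty_iff_false, iff_false]
      intro h
      apply hy
      ext ⟨i, hi⟩
      have hi' := Finset.mem_Iic.1 hi
      have := congrFun h ⟨i, Finset.mem_Iic.2 (by omega)⟩
      simpa [IicProdIoc, hi'] using this
  simp_rw [hint]
  rw [lintegral_indicator (measurableSet_singleton _), setLIntegral_const, mul_comm]

theorem chainLaw_walkUpTo_eq (P : Kernel V V) [IsMarkovKernel P] (a : V) (x : ℕ → V) (n : ℕ)
    (hx : x 0 = a) :
    chainLaw P a {ω | walkUpTo ω n = walkUpTo x n} = walkWeight P (walkUpTo x n) := by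
  have h1 : {ω : ℕ → V | walkUpTo ω n = walkUpTo x n} =
      Preorder.frestrictLe (π := fun _ => V) n ⁻¹' {Preorder.frestrictLe n x} := by
    ext ω
    simp only [Set.mem_ofPred_eq, walkUpTo_eq_iff, Set.mem_preimage, Set.mem_singleton_iff,
      funext_iff, Subtype.forall, Finset.mem_Iic]
    rfl
  rw [h1, chainLaw, ← Measure.map_apply (Preorder.measurable_frestrictLe n)
    (measurableSet_singleton _), Kernel.traj_map_frestrictLe_apply]
  clear h1
  induction n with
  | zero =>
    rw [Kernel.partialTraj_self, Kernel.id_apply, Measure.dirac_apply' _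
      (measurableSet_singleton _), Set.indicator_of_mem]
    · simp [walkUpTo, walkWeight]
    · ext ⟨i, hi⟩
      obtain rfl : i = 0 := by simpa using hi
      simp [hx]
  | succ n ih => rw [partialTraj_succ_singleton, ih, walkWeight_walkUpTo_succ]

theorem ae_chainLaw_zero (P : Kernel V V) [IsMarkovKernel P] (a : V) :
    ∀ᵐ ω ∂chainLaw P a, ω 0 = a := by
  have h := chainLaw_walkUpTo_eq P a (fun _ => a) 0 rfl
  refine (mem_ae_iff_prob_eq_one (measurableSet_eval_eq a 0)).2 ?_
  simpa [walkUpTo, walkWeight] using h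

theorem measurableSet_walkUpTo_mem (Q : Set (List V)) (n : ℕ) :
    MeasurableSet {ω : ℕ → V | walkUpTo ω n ∈ Q} := by
  have : {ω : ℕ → V | walkUpTo ω n ∈ Q} = ⋃ m ∈ Q, {ω | walkUpTo ω n = m} := by
    ext; simp
  rw [this]
  refine MeasurableSet.biUnion (Set.to_countable _) fun m _ => ?_
  by_cases hm : m.length = n + 1
  · obtain ⟨x, rfl⟩ := exists_eq_walkUpTo hm
    simp only [walkUpTo_eq_iff, Set.ofPred_forall]
    exact MeasurableSet.iInter fun i => MeasurableSet.iInter fun _ =>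
      measurableSet_eval_eq _ i
  · convert MeasurableSet.empty
    ext ω
    simp only [Set.mem_ofPred_eq, Set.mem_empty_iff_false, iff_false]
    rintro rfl
    simp [walkUpTo] at hm

end Cylinders

/-! ### The trajectory stopped upon hitting the boundary -/

section Stopping

variable {V : Type*} {S : Set V}

open Classical in
/-- The states of a walk that do not lie on the boundary. -/
noncomputable def interiorStates (S : Set V) (l : List V) : List V :=
  l.filter (fun v => v ∉ S)

theorem mem_interiorStates {l : List V} {v : V} : v ∈ interiorStates S l ↔ v ∈ l ∧ v ∉ S := by
  simp [interiorStates]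

open Classical in
/-- The states visited before the boundary is hit, where `a` is the initial state and `l` is the
list of interior states visited. -/
noncomputable def statesBeforeHit (S : Set V) (a : V) (l : List V) : List V :=
  if a ∈ S then a :: l else l

theorem FirstHitsAt.unique {ω : ℕ → V} {n n' : ℕ} (h : FirstHitsAt S ω n)
    (h' : FirstHitsAt S ω n') : n = n' := by
  rcases lt_trichotomy n n' with hlt | rfl | hlt
  · exact absurd h.2.1 (h'.2.2 n h.1 hlt)
  · rfl
  · exact absurd h'.2.1 (h.2.2 n' h'.1 hlt)

theorem walkUpTo_eq_cons (ω : ℕ → V) (n : ℕ) :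
    walkUpTo ω (n + 1) = ω 0 :: ((List.range n).map fun i => ω (i + 1)) ++ [ω (n + 1)] := by
  rw [walkUpTo_succ, walkUpTo, List.range_succ_eq_map]
  simp

theorem firstHitsAt_succ_iff {ω : ℕ → V} {n : ℕ} : FirstHitsAt S ω (n + 1) ↔
    ω (n + 1) ∈ S ∧ ∀ v ∈ (List.range n).map fun i => ω (i + 1), v ∉ S := by
  simp only [FirstHitsAt, Nat.succ_pos, true_and, List.mem_map, List.mem_range]
  refine and_congr_right fun _ => ⟨?_, ?_⟩
  · rintro h v ⟨i, hi, rfl⟩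
    exact h (i + 1) (by omega) (by omega)
  · intro h m h0 hm
    exact h _ ⟨m - 1, by omega, by congr 1; omega⟩

theorem interiorStates_cons_append {x y : V} {m : List V} (hm : ∀ v ∈ m, v ∉ S) (hy : y ∈ S) :
    statesBeforeHit S x (interiorStates S (x :: m ++ [y])) = x :: m := by
  have : interiorStates S m = m := List.filter_eq_self.2 (by simpa using hm)
  unfold interiorStates at this
  by_cases hx : x ∈ S <;> simp [statesBeforeHit, interiorStates, hx, hy] <;>
    simpa using this

theorem FirstHitsAt.walkUpTo_eq {ω : ℕ → V} {n : ℕ} (h : FirstHitsAt S ω n) :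
    walkUpTo ω n = statesBeforeHit S (ω 0) (interiorStates S (walkUpTo ω n)) ++ [ω n] := by
  obtain ⟨n, rfl⟩ := Nat.exists_eq_succ_of_ne_zero h.1.ne'
  have := firstHitsAt_succ_iff.1 h
  rw [Nat.succ_eq_add_one, walkUpTo_eq_cons, interiorStates_cons_append this.2 this.1]

theorem FirstHitsAt.head?_statesBeforeHit {ω : ℕ → V} {n : ℕ} (h : FirstHitsAt S ω n) :
    (statesBeforeHit S (ω 0) (interiorStates S (walkUpTo ω n))).head? = some (ω 0) := by
  obtain ⟨n, rfl⟩ := Nat.exists_eq_succ_of_ne_zero h.1.ne'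
  have := firstHitsAt_succ_iff.1 h
  rw [Nat.succ_eq_add_one, walkUpTo_eq_cons, interiorStates_cons_append this.2 this.1]
  rfl

/-- The event that the trajectory first hits the boundary at `b`, the interior states visited
before being those of the list `l`. -/
def hitEvent (S : Set V) (b : V) (l : List V) : Set (ℕ → V) :=
  {ω | ∃ n, FirstHitsAt S ω n ∧ ω n = b ∧ interiorStates S (walkUpTo ω n) = l}

theorem hitEvent_disjoint {b : V} {l l' : List V} {ω : ℕ → V} (h : ω ∈ hitEvent S b l)
    (h' : ω ∈ hitEvent S b l') : l = l' := by
  obtain ⟨n, hn, -, rfl⟩ := h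
  obtain ⟨n', hn', -, rfl⟩ := h'
  rw [hn.unique hn']

theorem mem_hitEvent_of_walkUpTo_eq {ω : ℕ → V} {a b : V} {l : List V} {n : ℕ} (hb : b ∈ S)
    (hl : ∀ v ∈ l, v ∉ S) (hhead : (statesBeforeHit S a l).head? = some a)
    (h : walkUpTo ω n = statesBeforeHit S a l ++ [b]) : ω ∈ hitEvent S b l := by
  -- At time `0` the walk would be `[b]` alone, leaving no room for the initial state required by
  -- `hhead`.
  rcases n with _ | n
  · have := congrArg List.length h
    simp [walkUpTo] at this
    simp [this] at hhead
  rw [walkUpTo_eq_cons] at h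
  obtain ⟨h1, h2⟩ := List.append_inj' h rfl
  have h2 : ω (n + 1) = b := by simpa using h2
  have h0 : ω 0 = a := by rw [← h1] at hhead; simpa using hhead
  have hit : FirstHitsAt S ω (n + 1) := by
    rw [firstHitsAt_succ_iff]
    refine ⟨h2 ▸ hb, fun v hv => ?_⟩
    by_cases ha : a ∈ S
    · simp only [statesBeforeHit, if_pos ha, List.cons.injEq] at h1
      exact hl v (h1.2 ▸ hv)
    · simp only [statesBeforeHit, if_neg ha] at h1
      exact hl v (h1 ▸ List.mem_cons_of_mem _ hv)
  refine ⟨n + 1, hit, h2, ?_⟩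
  have h3 := hit.walkUpTo_eq
  nth_rw 1 [walkUpTo_eq_cons] at h3
  rw [h1, h0] at h3
  have h4 := (List.append_inj' h3 rfl).1
  by_cases ha : a ∈ S
  · simpa [statesBeforeHit, ha] using h4.symm
  · simpa [statesBeforeHit, ha] using h4.symm

theorem mem_of_mem_statesBeforeHit {a b v : V} (hb : b ∈ S) {l : List V} (hv : v ∉ S)
    (h : v ∈ statesBeforeHit S a l ++ [b]) : v ∈ l := by
  unfold statesBeforeHit at h
  split_ifs at h with ha <;> simp only [List.mem_append, List.mem_cons, List.not_mem_nil, or_false]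
    at h <;> grind

/-! ### Hitting probabilities as weights of walks -/

section Measure

variable [MeasurableSpace V] [Countable V] [DiscreteMeasurableSpace V]

theorem measurableSet_hitEvent (b : V) (l : List V) : MeasurableSet (hitEvent S b l) := by
  have hF : ∀ n, MeasurableSet {ω : ℕ → V | FirstHitsAt S ω n} := fun n => by
    simp only [FirstHitsAt, Set.ofPred_and, Set.ofPred_forall]
    exact (MeasurableSet.const _).inter ((measurableSet_eval_mem S n).inter
      (MeasurableSet.iInter fun m => MeasurableSet.iInter fun _ => MeasurableSet.iInter fun _ =>
        measurableSet_eval_mem Sᶜ m))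
  simp only [hitEvent, Set.ofPred_exists, Set.ofPred_and]
  exact MeasurableSet.iUnion fun n => (hF n).inter
    ((measurableSet_eval_eq b n).inter
      (measurableSet_walkUpTo_mem {m | interiorStates S m = l} n))

open Classical in
-- The interior states determine the stopped walk, so the event is almost surely a cylinder. The
-- condition on the head matters only for an interior `a`, which must then be the first entry of
-- `l`.
theorem chainLaw_hitEvent (P : Kernel V V) [IsMarkovKernel P] (a : V) {b : V} (hb : b ∈ S)
    (l : List V) : chainLaw P a (hitEvent S b l) =
      if (∀ v ∈ l, v ∉ S) ∧ (statesBeforeHit S a l).head? = some a then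
        walkWeight P (statesBeforeHit S a l ++ [b]) else 0 := by
  split_ifs with h
  · obtain ⟨hl, hhead⟩ := h
    obtain ⟨x, hx⟩ := exists_eq_walkUpTo (m := statesBeforeHit S a l ++ [b])
      (n := (statesBeforeHit S a l).length) (by simp)
    have hx0 : x 0 = a := by
      have h1 : (statesBeforeHit S a l ++ [b]).head? = some a := by simp [hhead]
      rw [hx] at h1
      simpa [walkUpTo, List.range_succ_eq_map] using h1
    rw [hx, ← chainLaw_walkUpTo_eq P a x _ hx0, ← hx]
    -- `hitEvent` does not prescribe the initial state, so equality with the cylinder holds only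
    -- almost surely.
    refine measure_congr ?_
    filter_upwards [ae_chainLaw_zero P a] with ω hω
    refine propext ⟨?_, mem_hitEvent_of_walkUpTo_eq hb hl hhead⟩
    rintro ⟨n, hn, rfl, rfl⟩
    have h1 := hn.walkUpTo_eq
    rw [hω] at h1
    have h2 : n = (statesBeforeHit S a (interiorStates S (walkUpTo ω n))).length := by
      have := congrArg List.length h1
      simp only [List.length_append, List.length_singleton] at this
      simpa [walkUpTo] using this
    show walkUpTo ω _ = _
    rw [← h2]
    exact h1
  · rw [measure_eq_zero_iff_ae_notMem]
    filter_upwards [ae_chainLaw_zero P a] with ω hω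
    rintro ⟨n, hn, rfl, rfl⟩
    refine h ⟨fun v hv => (mem_interiorStates.1 hv).2, ?_⟩
    rw [← hω]
    exact hn.head?_statesBeforeHit

open Classical in
/-- The weight of the initial part of a trajectory started at `a` and visiting the interior states
of the list `l`. -/
noncomputable def initialWeight (P : Kernel V V) (S : Set V) (a : V) (l : List V) : ℝ :=
  if (∀ u ∈ l, u ∉ S) ∧ (statesBeforeHit S a l).head? = some a then
    (walkWeight P (statesBeforeHit S a l)).toReal else 0

open Classical in
/-- The weight of the final part of a trajectory visiting the interior states of the list `l` and
then hitting the boundary at `b`. -/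
noncomputable def finalWeight (P : Kernel V V) (S : Set V) (b : V) (l : List V) : ℝ :=
  if ∀ u ∈ l, u ∉ S then (walkWeight P (l ++ [b])).toReal else 0

/-- The probability that a trajectory hits the boundary after a given walk factorizes at each
vertex of this walk. -/
theorem chainLaw_hitEvent_append_cons (P : Kernel V V) [IsMarkovKernel P] (a : V) {b : V}
    (hb : b ∈ S) (x : List V) (v : V) (y : List V) :
    (chainLaw P a).real (hitEvent S b (x ++ v :: y)) =
      initialWeight P S a (x ++ [v]) * finalWeight P S b (v :: y) := by
  classical
  rw [measureReal_def, chainLaw_hitEvent P a hb, initialWeight, finalWeight]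
  have h1 : ∀ y, statesBeforeHit S a (x ++ v :: y) = statesBeforeHit S a x ++ v :: y := fun y => by
    unfold statesBeforeHit; split_ifs <;> simp
  have h2 : (statesBeforeHit S a x ++ v :: y).head? = (statesBeforeHit S a x ++ [v]).head? := by
    rcases statesBeforeHit S a x with _ | ⟨t, l⟩ <;> simp
  have h3 : (∀ u ∈ x ++ v :: y, u ∉ S) ↔ (∀ u ∈ x ++ [v], u ∉ S) ∧ ∀ u ∈ v :: y, u ∉ S := by
    simp only [List.mem_append, List.mem_cons]
    grind
  simp only [h1, h2, h3]
  rw [List.append_assoc, List.cons_append, walkWeight_append_cons]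
  by_cases hx : ∀ u ∈ x ++ [v], u ∉ S
  · by_cases hy : ∀ u ∈ v :: y, u ∉ S
    · by_cases hh : (statesBeforeHit S a x ++ [v]).head? = some a
      · rw [if_pos ⟨⟨hx, hy⟩, hh⟩, if_pos ⟨hx, hh⟩, if_pos hy, ENNReal.toReal_mul]
      · rw [if_neg (fun h => hh h.2), if_neg (fun h => hh h.2), zero_mul, ENNReal.toReal_zero]
    · rw [if_neg (fun h => hy h.1.2), if_neg hy, mul_zero, ENNReal.toReal_zero]
  · rw [if_neg (fun h => hx h.1.1), if_neg (fun h => hx h.1), zero_mul, ENNReal.toReal_zero]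

theorem isTrajectory_of_chainLaw_hitEvent_ne_zero {P : Kernel V V} [IsMarkovKernel P] {a b : V}
    (hb : b ∈ S) {l : List V} (h : (chainLaw P a).real (hitEvent S b l) ≠ 0) :
    IsTrajectory P S a b (statesBeforeHit S a l ++ [b]) := by
  classical
  rw [measureReal_def, chainLaw_hitEvent P a hb] at h
  split_ifs at h with hc
  · obtain ⟨hl, hhead⟩ := hc
    refine ⟨isChain_of_walkWeight_ne_zero fun e => h (by simp [e]), ?_⟩
    by_cases ha : a ∈ S
    · exact ⟨l, by simp [statesBeforeHit, ha], hl⟩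
    · simp only [statesBeforeHit, if_neg ha] at hhead ⊢
      obtain ⟨m, rfl⟩ := List.head?_eq_some_iff.1 hhead
      exact ⟨m, by simp, fun v hv => hl v (List.mem_cons_of_mem _ hv)⟩
  · simp at h

theorem exists_mem_of_trajectoriesCross {P : Kernel V V} [IsMarkovKernel P] {k : ℕ}
    {a : Fin k → V} {b : Fin k → S} (h : TrajectoriesCross P S a b) (i i' j j' : Fin k)
    (hi : i < i') (hj : j' < j) (p q : List V)
    (hp : (chainLaw P (a i)).real (hitEvent S (b j) p) ≠ 0)
    (hq : (chainLaw P (a i')).real (hitEvent S (b j') q) ≠ 0) : ∃ v ∈ p, v ∈ q := by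
  obtain ⟨v, hv, hvp, hvq⟩ := h i i' j j' hi hj _ _
    (isTrajectory_of_chainLaw_hitEvent_ne_zero (b j).2 hp)
    (isTrajectory_of_chainLaw_hitEvent_ne_zero (b j').2 hq)
  exact ⟨v, mem_of_mem_statesBeforeHit (b j).2 hv hvp, mem_of_mem_statesBeforeHit (b j').2 hv hvq⟩

open Classical in
/-- The law of a tuple of independent trajectories decomposes according to the interior states
visited before hitting the boundary. -/
theorem hasSum_pi_chainLaw (P : Kernel V V) [IsMarkovKernel P] {k : ℕ} (a : Fin k → V)
    (c : Fin k → V) (C : (Fin k → List V) → Prop) :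
    HasSum (fun p => if C p then ∏ i, (chainLaw P (a i)).real (hitEvent S (c i) (p i)) else 0)
      ((Measure.pi fun i => chainLaw P (a i)).real
        {π | ∃ p, C p ∧ ∀ i, π i ∈ hitEvent S (c i) (p i)}) := by
  let E : (Fin k → List V) → Set (Fin k → ℕ → V) := fun p =>
    if C p then Set.pi Set.univ fun i => hitEvent S (c i) (p i) else ∅
  have hE : {π | ∃ p, C p ∧ ∀ i, π i ∈ hitEvent S (c i) (p i)} = ⋃ p, E p := by
    ext π
    simp only [Set.mem_ofPred_eq, Set.mem_iUnion, E]
    refine exists_congr fun p => ?_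
    by_cases h : C p <;> simp [h]
  have hm : ∀ p, MeasurableSet (E p) := fun p => by
    simp only [E]
    split_ifs
    · exact MeasurableSet.univ_pi fun i => measurableSet_hitEvent _ _
    · exact MeasurableSet.empty
  have hd : Pairwise (Function.onFun Disjoint E) := fun p q hpq => by
    refine Set.disjoint_left.2 fun π h1 h2 => hpq ?_
    simp only [E] at h1 h2
    split_ifs at h1 h2
    · exact funext fun i => hitEvent_disjoint (h1 i (Set.mem_univ i)) (h2 i (Set.mem_univ i))
    all_goals simp_all
  have hsum := measure_iUnion (μ := Measure.pi fun i => chainLaw P (a i)) hd hm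
  rw [hE, measureReal_def, hsum, ENNReal.tsum_toReal_eq fun p => measure_ne_top _ _]
  convert ENNReal.hasSum_toReal (hsum ▸ measure_ne_top _ _) using 1
  funext p
  simp only [E]
  split_ifs
  · rw [Measure.pi_pi, ENNReal.toReal_prod]
    rfl
  · simp

theorem hasSum_prod_hittingMatrix (P : Kernel V V) [IsMarkovKernel P] {k : ℕ} (a : Fin k → V)
    (b : Fin k → S) :
    HasSum (fun p : Fin k → List V => ∏ i, (chainLaw P (a i)).real (hitEvent S (b i) (p i)))
      (∏ i, hittingMatrix P S (a i) (b i)) := by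
  have h := hasSum_pi_chainLaw (S := S) P a (fun i => b i) (fun _ => True)
  simp only [if_true, true_and] at h
  convert h using 1
  have : {π : Fin k → ℕ → V | ∃ p : Fin k → List V, ∀ i, π i ∈ hitEvent S (b i) (p i)} =
      Set.pi Set.univ fun i => {ω | ∃ n, FirstHitsAt S ω n ∧ ω n = b i} := by
    ext π
    simp only [hitEvent, Set.mem_ofPred_eq, Set.mem_pi, Set.mem_univ, true_imp_iff]
    constructor
    · rintro ⟨p, hp⟩ i
      obtain ⟨n, h1, h2, -⟩ := hp i
      exact ⟨n, h1, h2⟩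
    · intro h
      choose n h1 h2 using h
      exact ⟨_, fun i => ⟨n i, h1 i, h2 i, rfl⟩⟩
  rw [this, measureReal_def, Measure.pi_pi, ENNReal.toReal_prod]
  rfl

end Measure

/-! ### Loop erasure and removal of the boundary endpoints -/

section LoopErased

variable [DecidableEq V]

theorem loopErase_cons_of_notMem {x : V} {l : List V} (h : x ∉ l) :
    loopErase (x :: l) = x :: loopErase l := by
  suffices key : ∀ l c : List V, x ∉ l →
      l.foldl (fun p v => p.takeWhile (fun u => u ≠ v) ++ [v]) (x :: c) =
        x :: l.foldl (fun p v => p.takeWhile (fun u => u ≠ v) ++ [v]) c from key l [] h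
  intro l
  induction l with
  | nil => intro c _; rfl
  | cons u l ih =>
    intro c hu
    simp only [List.mem_cons, not_or] at hu
    rw [List.foldl_cons, List.foldl_cons, List.takeWhile_cons_of_pos (by simpa using hu.1)]
    exact ih _ hu.2

theorem loopErase_concat_of_notMem {x : V} {l : List V} (h : x ∉ l) :
    loopErase (l ++ [x]) = loopErase l ++ [x] := by
  rw [loopErase_append_cons, List.foldl_nil, List.takeWhile_eq_self_iff.2]
  intro u hu
  simpa using fun e : u = x => h (e ▸ loopErase_subset _ hu)

/-- Boundary states occur only at the two ends of a stopped trajectory. Since a return to the start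
at the last step does not close a loop, they affect no erasure and can be stripped first. -/
theorem mem_trajectoryLoopErase_iff {ω : ℕ → V} {n : ℕ} (h : FirstHitsAt S ω n) {v : V}
    (hv : v ∉ S) : v ∈ trajectoryLoopErase (walkUpTo ω n) ↔
      v ∈ loopErase (interiorStates S (walkUpTo ω n)) := by
  obtain ⟨n, rfl⟩ := Nat.exists_eq_succ_of_ne_zero h.1.ne'
  obtain ⟨hy, hm⟩ := firstHitsAt_succ_iff.1 h
  rw [Nat.succ_eq_add_one, walkUpTo_eq_cons]
  generalize ω 0 = x at *
  generalize ω (n + 1) = y at *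
  generalize (List.range n).map (fun i => ω (i + 1)) = m at *
  have hvy : v ≠ y := fun e => hv (e ▸ hy)
  have hym : y ∉ m := fun e => hm y e hy
  have h1 : v ∈ trajectoryLoopErase (x :: m ++ [y]) ↔ v ∈ loopErase (x :: m) := by
    have hhead : (x :: m ++ [y]).head? = some x := rfl
    have hlast : (x :: m ++ [y]).getLast? = some y := List.getLast?_concat
    rw [trajectoryLoopErase, hhead, hlast, List.dropLast_concat]
    split_ifs with hxy
    · simp [hvy]
    · rw [loopErase_concat_of_notMem]
      · simp [hvy]
      · simp only [Option.some.injEq] at hxy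
        simp [Ne.symm hxy, hym]
  have h2 := interiorStates_cons_append (x := x) hm hy
  rw [h1]
  -- A boundary start is never revisited in `m`, so it is merely prepended to the loop erasure; an
  -- interior start already belongs to the list.
  by_cases hx : x ∈ S
  · simp only [statesBeforeHit, if_pos hx, List.cons.injEq, true_and] at h2
    rw [h2, loopErase_cons_of_notMem (fun e => hm x e hx), List.mem_cons]
    exact or_iff_right (fun e => hv (e ▸ hx))
  · simp only [statesBeforeHit, if_neg hx] at h2
    rw [h2]

theorem nonintersectionEvent_eq {k : ℕ} (b : Fin k → S) :
    nonintersectionEvent S b =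
      {π | ∃ p, ConsecutiveDisjoint p ∧ ∀ i, π i ∈ hitEvent S (b i) (p i)} := by
  ext π
  constructor
  · rintro ⟨τ, hτ, hd⟩
    refine ⟨fun i => interiorStates S (walkUpTo (π i) (τ i)), fun i j hij v hv => ?_,
      fun i => ⟨τ i, (hτ i).1, (hτ i).2, rfl⟩⟩
    obtain ⟨h1, h2⟩ := mem_interiorStates.1 hv
    exact fun h => hd i j hij v h2 h1 ((mem_trajectoryLoopErase_iff (hτ i).1 h2).2 h)
  · rintro ⟨p, hp, hπ⟩
    choose τ h1 h2 h3 using hπ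
    refine ⟨τ, fun i => ⟨h1 i, h2 i⟩, fun i j hij v hv hvj hvi => ?_⟩
    refine hp i j hij v ?_ ?_
    · rw [← h3 j]
      exact mem_interiorStates.2 ⟨hvj, hv⟩
    · rw [← h3 i]
      exact (mem_trajectoryLoopErase_iff (h1 i) hv).1 hvi

end LoopErased

end Stopping

/-- The determinant of a submatrix of the hitting matrix is the probability of the nonintersection
event, if the trajectories have to cross. -/
theorem det_hittingMatrix_eq {V : Type*} [Countable V] [DecidableEq V] [MeasurableSpace V]
    [DiscreteMeasurableSpace V] (P : Kernel V V) [IsMarkovKernel P] (S : Set V) (k : ℕ)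
    (a : Fin k → V) (b : Fin k → S) (hcross : TrajectoriesCross P S a b) :
    ((hittingMatrix P S).submatrix a b).det =
      (Measure.pi fun i => chainLaw P (a i)).real (nonintersectionEvent S b) := by
  classical
  rw [nonintersectionEvent_eq,
    ← (hasSum_pi_chainLaw P a (fun i => b i) ConsecutiveDisjoint).tsum_eq,
    det_tsum_eq_tsum_consecutiveDisjoint
      (w := fun i j l => (chainLaw P (a i)).real (hitEvent S (b j) l))
      (A := fun i => initialWeight P S (a i)) (B := fun j => finalWeight P S (b j))
      (fun i j x v y => chainLaw_hitEvent_append_cons P (a i) (b j).2 x v y)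
      (exists_mem_of_trajectoriesCross hcross)
      (fun σ => hasSum_prod_hittingMatrix P a (fun i => b (σ i)))]

theorem TrajectoriesCross.submatrix {V : Type*} [MeasurableSpace V] {P : Kernel V V} {S : Set V}
    {k m : ℕ} {a : Fin k → V} {b : Fin k → S} (h : TrajectoriesCross P S a b)
    {r c : Fin m → Fin k} (hr : StrictMono r) (hc : StrictMono c) :
    TrajectoriesCross P S (a ∘ r) (b ∘ c) :=
  fun i i' j j' hi hj => h (r i) (r i') (c j) (c j') (hr hi) (hc hj)

end HittingMinors

theorem mainTheorem5 {V : Type*} [Countable V] [DecidableEq V] [MeasurableSpace V]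
    [DiscreteMeasurableSpace V] (P : ProbabilityTheory.Kernel V V)
    [ProbabilityTheory.IsMarkovKernel P] (S : Set V) (k : ℕ) (a : Fin k → V) (b : Fin k → S)
    (ha : Function.Injective a) (hb : Function.Injective b)
    (hcross : HittingMinors.TrajectoriesCross P S a b) :
    ((HittingMinors.hittingMatrix P S).submatrix a b).det =
        (MeasureTheory.Measure.pi fun i => HittingMinors.chainLaw P (a i)).real
          (HittingMinors.nonintersectionEvent S b) ∧
      0 ≤ ((HittingMinors.hittingMatrix P S).submatrix a b).det ∧
      HittingMinors.IsTotallyNonnegative ((HittingMinors.hittingMatrix P S).submatrix a b) := by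
  refine ⟨HittingMinors.det_hittingMatrix_eq P S k a b hcross, ?_, fun m r c hr hc => ?_⟩
  · rw [HittingMinors.det_hittingMatrix_eq P S k a b hcross]
    exact measureReal_nonneg
  · rw [Matrix.submatrix_submatrix,
      HittingMinors.det_hittingMatrix_eq P S m _ _ (hcross.submatrix hr hc)]
    exact measureReal_nonneg
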